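/- Let $S$ be the semigroup given by the semigroup presentation with generators $a,b,c,d,e,f,x,y$ and defining relations $$cabd=a,\quad eca=a,\quad abf^2=ab,\quad abf=xa,\quad yabf=a,\quad f^3=f,$$ $$ec=ce,\quad ex=xe,\quad ey=ye,\quad cx=xc,\quad cy=yc,\quad xy=yx.$$ For a semigroup $U$, let $U^1$ denote $U$ with an identity adjoined; Green's relations on $U$ are defined by $u\,\mathcal L\,v \iff U^1u=U^1v$, $u\,\mathcal R\,v\iff uU^1=vU^1$, $u\,\mathcal J\,v\iff U^1uU^1=U^1vU^1$, and $\mathcal D=\mathcal L\circ\mathcal R$, that is, $u\,\mathcal D\,v$ if and only if there is $m\in U$ with $u\,\mathcal L\,m$ and $m\,\mathcal R\,v$. Then $T=S\setminus\{f\}$ is a subsemigroup of $S$; it is large, i.e. its complement in $S$ is finite (consisting of the single element $f$). Moreover $\mathcal J=\mathcal D$ in the semigroup $S$, but $\mathcal J\neq\mathcal D$ in the semigroup $T$ (where Green's relations of $T$ are computed in $T$ itself). Thus the property $\mathcal J=\mathcal D$ is not inherited by large subsemigroups, even by those whose complement is a single element. -/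

import Mathlib

namespace SemigroupExample

/-! ### Green's relations

`WithOne S` adjoins a fresh identity to `S` even if `S` already has one; the principal
ideals `S¹ u`, `u S¹` and `S¹ u S¹` below are the same under either convention. -/

section Green

/-- The principal left ideal `S¹ u`. -/
def leftIdeal {S : Type*} [Semigroup S] (u : S) : Set S :=
  {z | ∃ p : WithOne S, (z : WithOne S) = p * (u : WithOne S)}

/-- The principal right ideal `u S¹`. -/
def rightIdeal {S : Type*} [Semigroup S] (u : S) : Set S :=
  {z | ∃ q : WithOne S, (z : WithOne S) = (u : WithOne S) * q}

/-- The principal two-sided ideal `S¹ u S¹`. -/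
def twoSidedIdeal {S : Type*} [Semigroup S] (u : S) : Set S :=
  {z | ∃ p q : WithOne S, (z : WithOne S) = p * (u : WithOne S) * q}

/-- Green's relation `L` on the semigroup `S`. -/
def GreenL (S : Type*) [Semigroup S] (u v : S) : Prop := leftIdeal u = leftIdeal v

/-- Green's relation `R` on the semigroup `S`. -/
def GreenR (S : Type*) [Semigroup S] (u v : S) : Prop := rightIdeal u = rightIdeal v

/-- Green's relation `J` on the semigroup `S`. -/
def GreenJ (S : Type*) [Semigroup S] (u v : S) : Prop := twoSidedIdeal u = twoSidedIdeal v

/-- Green's relation `D = L ∘ R` on the semigroup `S`. -/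
def GreenD (S : Type*) [Semigroup S] (u v : S) : Prop := ∃ m : S, GreenL S u m ∧ GreenR S m v

end Green

/-- A subsemigroup is large if its complement is finite, i.e. if its Rees index
`|S - T| + 1` is finite. -/
def IsLarge {S : Type*} [Semigroup S] (T : Subsemigroup S) : Prop := ((T : Set S)ᶜ).Finite

/-! ### The presented semigroup -/

/-- The generators. -/
inductive Gen : Type
  | a | b | c | d | e | f | x | y
  deriving DecidableEq

section Presentation

open FreeSemigroup Gen

/-- The defining relations, as pairs of words over the generators. -/
inductive Rel : FreeSemigroup Gen → FreeSemigroup Gen → Prop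
  | cabd : Rel (of c * of a * of b * of d) (of a)
  | eca : Rel (of e * of c * of a) (of a)
  | abff : Rel (of a * of b * of f * of f) (of a * of b)
  | abf : Rel (of a * of b * of f) (of x * of a)
  | yabf : Rel (of y * of a * of b * of f) (of a)
  | fff : Rel (of f * of f * of f) (of f)
  | ec : Rel (of e * of c) (of c * of e)
  | ex : Rel (of e * of x) (of x * of e)
  | ey : Rel (of e * of y) (of y * of e)
  | cx : Rel (of c * of x) (of x * of c)
  | cy : Rel (of c * of y) (of y * of c)
  | xy : Rel (of x * of y) (of y * of x)

end Presentation

/-- The semigroup presented by the generators `Gen` and the relations `Rel`: the quotient of the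
free semigroup by the congruence generated by `Rel`. -/
abbrev S : Type := (conGen Rel).Quotient

/-- The element of `S` represented by a generator. -/
def gen (g : Gen) : S := (FreeSemigroup.of g : FreeSemigroup Gen)

end SemigroupExample

namespace SemigroupExample

open Gen

/-! ### Green's relations as pairs of divisibility equations -/

section Green

variable {U : Type*} [Semigroup U]

/-! The relations give `aff = a`, `ab = xaf` and `afd = eya`, and on the left of `a` the letters `c,
e` and `x, y` act as commuting inverse pairs. After such a live `a`, reading `f` toggles between `a`
and `af`, while `b` and `d` are absorbed and change only the exponents on the left.

If `u J v` in `S`, then `u = p p' u q' q`. The count of `a` shows that the outer factors contain no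
`a`. A left action (`lrun`) shows that `p p'` is a power of `f` or a word in `c, e, x, y` acting
invertibly on `u`, so left multiplication by `p'` can be undone (`exists_left_inverse`). A right
action (`run`) shows that `q' q` is a power of `f`, hence also undoable, unless `u` and `v` both
have the form `za` or `zaf` with `z` a word in `c, e, x, y`; all such elements form one D-class
(`greenD_of_isLive`).

In `T`, `a` and `af` are still J-related, through `b` and `d`. A D-relation would give `pa = afq`
and `af = par`; the right action forces `qr` to be a power of `f` and `r` to be an odd one, so `r =
f`, which is not in `T`. -/

lemma greenL_iff {u v : U} : GreenL U u v ↔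
    (∃ p : WithOne U, (u : WithOne U) = p * v) ∧ ∃ p : WithOne U, (v : WithOne U) = p * u := by
  constructor
  · intro h
    have hu : u ∈ leftIdeal v := by
      rw [← show leftIdeal u = leftIdeal v from h]; exact ⟨1, by simp⟩
    have hv : v ∈ leftIdeal u := by
      rw [show leftIdeal u = leftIdeal v from h]; exact ⟨1, by simp⟩
    exact ⟨hu, hv⟩
  · rintro ⟨⟨p, hp⟩, ⟨q, hq⟩⟩
    ext z
    constructor
    · rintro ⟨r, hr⟩
      exact ⟨r * p, by rw [hr, hp, mul_assoc]⟩
    · rintro ⟨r, hr⟩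
      exact ⟨r * q, by rw [hr, hq, mul_assoc]⟩

lemma greenR_iff {u v : U} : GreenR U u v ↔
    (∃ p : WithOne U, (u : WithOne U) = v * p) ∧ ∃ p : WithOne U, (v : WithOne U) = u * p := by
  constructor
  · intro h
    have hu : u ∈ rightIdeal v := by
      rw [← show rightIdeal u = rightIdeal v from h]; exact ⟨1, by simp⟩
    have hv : v ∈ rightIdeal u := by
      rw [show rightIdeal u = rightIdeal v from h]; exact ⟨1, by simp⟩
    exact ⟨hu, hv⟩
  · rintro ⟨⟨p, hp⟩, ⟨q, hq⟩⟩
    ext z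
    constructor
    · rintro ⟨r, hr⟩
      exact ⟨p * r, by rw [hr, hp, mul_assoc]⟩
    · rintro ⟨r, hr⟩
      exact ⟨q * r, by rw [hr, hq, mul_assoc]⟩

lemma greenJ_iff {u v : U} : GreenJ U u v ↔
    (∃ p q : WithOne U, (u : WithOne U) = p * v * q) ∧
      ∃ p q : WithOne U, (v : WithOne U) = p * u * q := by
  constructor
  · intro h
    have hu : u ∈ twoSidedIdeal v := by
      rw [← show twoSidedIdeal u = twoSidedIdeal v from h]; exact ⟨1, 1, by simp⟩
    have hv : v ∈ twoSidedIdeal u := by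
      rw [show twoSidedIdeal u = twoSidedIdeal v from h]; exact ⟨1, 1, by simp⟩
    exact ⟨hu, hv⟩
  · rintro ⟨⟨p, p', hp⟩, ⟨q, q', hq⟩⟩
    ext z
    constructor
    · rintro ⟨r, r', hr⟩
      exact ⟨r * p, p' * r', by rw [hr, hp]; simp only [mul_assoc]⟩
    · rintro ⟨r, r', hr⟩
      exact ⟨r * q, q' * r', by rw [hr, hq]; simp only [mul_assoc]⟩

lemma GreenD.greenJ {u v : U} (h : GreenD U u v) : GreenJ U u v := by
  obtain ⟨m, hL, hR⟩ := h
  obtain ⟨⟨p, hp⟩, ⟨p', hp'⟩⟩ := greenL_iff.1 hL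
  obtain ⟨⟨q, hq⟩, ⟨q', hq'⟩⟩ := greenR_iff.1 hR
  exact greenJ_iff.2 ⟨⟨p, q, by rw [hp, hq, mul_assoc]⟩, ⟨p', q', by rw [hq', hp']⟩⟩

end Green

/-! ### Words and their values -/

/-- The value of a word in `S` with an identity adjoined. -/
def ev (w : List Gen) : WithOne S := (w.map fun g => (gen g : WithOne S)).prod

@[simp] lemma ev_nil : ev [] = 1 := rfl

@[simp] lemma ev_cons (g : Gen) (w : List Gen) : ev (g :: w) = gen g * ev w := by simp [ev]

@[simp] lemma ev_append (v w : List Gen) : ev (v ++ w) = ev v * ev w := by simp [ev]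

lemma exists_ev_coe (u : S) : ∃ w, ev w = u := by
  induction u using Con.induction_on with
  | H w =>
    induction w using FreeSemigroup.recOnMul with
    | ih1 g => exact ⟨[g], by simp [gen]⟩
    | ih2 g w hg hw =>
      obtain ⟨s, hs⟩ := hg
      obtain ⟨t, ht⟩ := hw
      exact ⟨s ++ t, by rw [ev_append, hs, ht]; rfl⟩

lemma exists_ev (p : WithOne S) : ∃ w, ev w = p := by
  cases p with
  | one => exact ⟨[], rfl⟩
  | coe u => exact exists_ev_coe u

lemma coe_eq_of_rel {u v : FreeSemigroup Gen} (h : Rel u v) :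
    (((u : FreeSemigroup Gen) : S) : WithOne S) = ((v : S) : WithOne S) :=
  congrArg _ ((Con.eq _).2 (ConGen.Rel.of _ _ h))

/-- A generator, as an element of `S` with an identity adjoined. -/
local notation "γ" g:max => ((gen g : S) : WithOne S)

/-! ### The defining relations and their consequences -/

lemma cabd_eq : γ c * γ a * γ b * γ d = γ a := coe_eq_of_rel Rel.cabd
lemma eca_eq : γ e * γ c * γ a = γ a := coe_eq_of_rel Rel.eca
lemma abff_eq : γ a * γ b * γ f * γ f = γ a * γ b := coe_eq_of_rel Rel.abff
lemma abf_eq : γ a * γ b * γ f = γ x * γ a := coe_eq_of_rel Rel.abf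
lemma yabf_eq : γ y * γ a * γ b * γ f = γ a := coe_eq_of_rel Rel.yabf
lemma fff_eq : γ f * γ f * γ f = γ f := coe_eq_of_rel Rel.fff
lemma ec_eq : γ e * γ c = γ c * γ e := coe_eq_of_rel Rel.ec
lemma ex_eq : γ e * γ x = γ x * γ e := coe_eq_of_rel Rel.ex
lemma ey_eq : γ e * γ y = γ y * γ e := coe_eq_of_rel Rel.ey
lemma cx_eq : γ c * γ x = γ x * γ c := coe_eq_of_rel Rel.cx
lemma cy_eq : γ c * γ y = γ y * γ c := coe_eq_of_rel Rel.cy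
lemma xy_eq : γ x * γ y = γ y * γ x := coe_eq_of_rel Rel.xy

lemma yxa_eq : γ y * (γ x * γ a) = γ a := by
  rw [← abf_eq, ← mul_assoc, ← mul_assoc, yabf_eq]

lemma xaf_eq : γ x * γ a * γ f = γ a * γ b := by rw [← abf_eq, abff_eq]

lemma aff_eq : γ a * γ f * γ f = γ a := by
  calc γ a * γ f * γ f = γ y * (γ x * γ a) * γ f * γ f := by rw [yxa_eq]
    _ = γ y * (γ x * γ a * γ f * γ f) := by simp only [mul_assoc]
    _ = γ a := by rw [xaf_eq, abf_eq, yxa_eq]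

lemma cxafd_eq : γ c * (γ x * (γ a * γ f * γ d)) = γ a := by
  calc _ = γ c * (γ x * γ a * γ f) * γ d := by simp only [mul_assoc]
    _ = γ a := by rw [xaf_eq, ← mul_assoc, cabd_eq]

/-- Writing `a = ec·yx·a` and moving `c` past `y` produces the factor `cxafd = cabd = a`. -/
lemma afd_eq : γ a * γ f * γ d = γ e * γ y * γ a := by
  calc γ a * γ f * γ d = γ e * γ c * (γ y * (γ x * γ a)) * γ f * γ d := by
        rw [yxa_eq, eca_eq]
    _ = γ e * (γ c * γ y) * γ x * γ a * γ f * γ d := by simp only [mul_assoc]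
    _ = γ e * γ y * (γ c * (γ x * (γ a * γ f * γ d))) := by rw [cy_eq]; simp only [mul_assoc]
    _ = _ := by rw [cxafd_eq]

/-! ### Invariants of words -/

/-- A monoid-valued assignment to the generators respecting the relations extends to `S` with an
identity adjoined. -/
lemma map_prod_eq_of_ev_eq {M : Type*} [Monoid M] (m : Gen → M)
    (h : ∀ u v, Rel u v → FreeSemigroup.lift m u = FreeSemigroup.lift m v)
    {v w : List Gen} (hvw : ev v = ev w) : (v.map m).prod = (w.map m).prod := by
  let φ : S →ₙ* M :=
    { toFun := fun s => Con.liftOn s (FreeSemigroup.lift m) (by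
        intro u v huv
        have : conGen Rel ≤ Con.ker (FreeSemigroup.lift m) := Con.conGen_le.2 h
        exact this huv)
      map_mul' := by
        intro s t
        induction s, t using Con.induction_on₂ with
        | H s t => exact map_mul (FreeSemigroup.lift m) s t }
  have key : ∀ w, WithOne.lift φ (ev w) = (w.map m).prod := by
    intro w
    induction w with
    | nil => simp
    | cons g w ih =>
      rw [ev_cons, map_mul, ih, List.map_cons, List.prod_cons, WithOne.lift_coe]
      rfl
  rw [← key, ← key, hvw]

lemma count_a_eq {v w : List Gen} (h : ev v = ev w) : v.count a = w.count a := by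
  have := map_prod_eq_of_ev_eq (M := Multiplicative ℕ)
    (fun g => Multiplicative.ofAdd (if g = a then 1 else 0))
    (by intro u v h; cases h <;> rfl) h
  have key : ∀ w : List Gen, (w.map fun g =>
      Multiplicative.ofAdd (if g = a then 1 else 0)).prod = Multiplicative.ofAdd (w.count a) := by
    intro w
    induction w with
    | nil => rfl
    | cons g w ih =>
      rw [List.map_cons, List.prod_cons, ih, ← ofAdd_add, List.count_cons, add_comm]
      simp
  rw [key, key] at this
  exact this

/-- What has been read of a word, from left to right. -/
inductive State : Type
  /-- `pend k i j`: the part after the last `a` is not absorbed by that `a`; it has `k` letters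
  other than `f`, and its final block of letters `c, e, x, y` has degree `i` in `e = c⁻¹` and `j`
  in `x = y⁻¹`. -/
  | pend (k : ℕ) (i j : ℤ)
  /-- `live i j t`: what has been read ends in `eⁱxʲa` or in `eⁱxʲaf`, according to `t`. -/
  | live (i j : ℤ) (t : Bool)

open State

/-- The right action of the generators on states. -/
def step : State → Gen → State
  | pend _ i j, a => live i j false
  | pend k _ _, b => pend (k + 1) 0 0
  | pend k i j, c => pend (k + 1) (i - 1) j
  | pend k _ _, d => pend (k + 1) 0 0
  | pend k i j, e => pend (k + 1) (i + 1) j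
  | pend k _ _, f => pend k 0 0
  | pend k i j, x => pend (k + 1) i (j + 1)
  | pend k i j, y => pend (k + 1) i (j - 1)
  | live _ _ _, a => live 0 0 false
  | live i j false, b => live i (j + 1) true
  | live _ _ true, b => pend 1 0 0
  | live _ _ _, c => pend 1 (-1) 0
  | live _ _ false, d => pend 1 0 0
  | live i j true, d => live (i + 1) (j - 1) false
  | live _ _ _, e => pend 1 1 0
  | live i j t, f => live i j !t
  | live _ _ _, x => pend 1 0 1
  | live _ _ _, y => pend 1 0 (-1)

/-- The state after reading a word. -/
abbrev run (s : State) (w : List Gen) : State := w.foldl step s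

/-- The transitions on live states encode `ab = xaf`, `afd = eya` and `aff = a`, so both sides of
every relation act alike on every state. -/
lemma run_eq_of_rel {u v : FreeSemigroup Gen} (h : Rel u v) (s : State) :
    run s (u.head :: u.tail) = run s (v.head :: v.tail) := by
  cases h <;> rcases s with ⟨k, i, j⟩ | ⟨i, j, _ | _⟩ <;> simp [step]

lemma run_eq {v w : List Gen} (h : ev v = ev w) (s : State) : run s v = run s w := by
  -- Words are read from left to right, so the action is a homomorphism into the opposite of the
  -- endomorphism monoid.
  have := map_prod_eq_of_ev_eq (M := (Function.End State)ᵐᵒᵖ)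
    (fun g => MulOpposite.op (fun s => step s g))
    (by
      intro u v h
      have key (w : FreeSemigroup Gen) : ∀ s, (FreeSemigroup.lift (fun g =>
          (MulOpposite.op fun s => step s g : (Function.End State)ᵐᵒᵖ)) w).unop s =
          run s (w.head :: w.tail) := by
        induction w using FreeSemigroup.recOnMul with
        | ih1 g => intro s; rfl
        | ih2 g w hg hw =>
          intro s
          rw [map_mul, MulOpposite.unop_mul]
          exact hw _
      apply MulOpposite.unop_injective
      funext s
      rw [key, key, run_eq_of_rel h]) h
  have key : ∀ (w : List Gen) (s : State),
      (w.map fun g => (MulOpposite.op (fun s => step s g) :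
        (Function.End State)ᵐᵒᵖ)).prod.unop s = run s w := by
    intro w
    induction w with
    | nil => intro s; rfl
    | cons g w ih =>
      intro s
      rw [List.map_cons, List.prod_cons, MulOpposite.unop_mul, Function.End.mul_def]
      exact ih _
  rw [← key, ← key, this]

/-- The left action of the generators that counts, in the part of a word before its first `a`, the
letters other than `f` up to the last letter `b`, `d` or `f`. -/
def lstep : Gen → Option ℕ → Option ℕ
  | a, _ => none
  | b, o => some (o.getD 0 + 1)
  | d, o => some (o.getD 0 + 1)
  | f, o => some (o.getD 0)
  | c, o => o.map (· + 1)
  | e, o => o.map (· + 1)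
  | x, o => o.map (· + 1)
  | y, o => o.map (· + 1)

/-- The left action of a word. -/
abbrev lrun (w : List Gen) (o : Option ℕ) : Option ℕ := w.foldr lstep o

/-- Letters `c, e, x, y` adjacent to the first `a` may cancel, so they must not be counted; those
before a `b`, `d` or `f` can only be permuted. -/
lemma lrun_eq_of_rel {u v : FreeSemigroup Gen} (h : Rel u v) (o : Option ℕ) :
    lrun (u.head :: u.tail) o = lrun (v.head :: v.tail) o := by
  cases h <;> cases o <;> simp [lstep]

lemma lrun_eq {v w : List Gen} (h : ev v = ev w) (o : Option ℕ) : lrun v o = lrun w o := by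
  have := map_prod_eq_of_ev_eq (M := Function.End (Option ℕ)) lstep
    (by
      intro u v h
      have key (w : FreeSemigroup Gen) : ∀ o, FreeSemigroup.lift (β := Function.End (Option ℕ))
          lstep w o = lrun (w.head :: w.tail) o := by
        induction w using FreeSemigroup.recOnMul with
        | ih1 g => intro o; rfl
        | ih2 g w hg hw =>
          intro o
          rw [map_mul]
          exact congrArg (lstep g) (hw o)
      funext o
      exact (key u o).trans ((lrun_eq_of_rel h o).trans (key v o).symm)) h
  have key : ∀ (w : List Gen) (o : Option ℕ),
      (List.map (β := Function.End (Option ℕ)) lstep w).prod o = lrun w o := by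
    intro w
    induction w with
    | nil => intro s; rfl
    | cons g w ih =>
      intro s
      exact congrArg (lstep g) (ih s)
  rw [← key, ← key, this]

/-! ### Words in `f` and words in `c, e, x, y` -/

/-- The letters `c, e, x, y`. -/
def IsUnitLetter (g : Gen) : Prop := g = c ∨ g = e ∨ g = x ∨ g = y

/-- The word consists of letters `f`. -/
def IsFWord (w : List Gen) : Prop := ∀ g ∈ w, g = f

/-- The number of letters other than `f`. -/
def nonF (w : List Gen) : ℕ := w.countP (· ≠ f)

lemma nonF_eq_zero {w : List Gen} : nonF w = 0 ↔ IsFWord w := by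
  simp [nonF, IsFWord]

/-- The word consists of letters `c, e, x, y`. -/
def IsUnitWord (w : List Gen) : Prop := ∀ g ∈ w, IsUnitLetter g

lemma isFWord_append {v w : List Gen} : IsFWord (v ++ w) ↔ IsFWord v ∧ IsFWord w := by
  simp [IsFWord, or_imp, forall_and]

lemma isUnitWord_append {v w : List Gen} :
    IsUnitWord (v ++ w) ↔ IsUnitWord v ∧ IsUnitWord w := by
  simp [IsUnitWord, or_imp, forall_and]

lemma IsFWord.ev_cases {w : List Gen} (h : IsFWord w) :
    w = [] ∨ ev w = γ f * γ f ∨ ev w = γ f := by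
  induction w with
  | nil => simp
  | cons g w ih =>
    obtain rfl : g = f := h g (by simp)
    right
    rcases ih (fun g hg => h g (by simp [hg])) with rfl | hw | hw
    · simp
    · right
      rw [ev_cons, hw, ← mul_assoc, fff_eq]
    · left
      rw [ev_cons, hw]

lemma IsFWord.mul_ff {w : List Gen} (h : IsFWord w) (hw : w ≠ []) :
    ev w * (γ f * γ f) = ev w := by
  rcases h.ev_cases with h | h | h
  · exact absurd h hw
  · rw [h, ← mul_assoc, fff_eq]
  · rw [h, ← mul_assoc, fff_eq]

lemma IsFWord.ff_mul {w : List Gen} (h : IsFWord w) (hw : w ≠ []) :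
    γ f * γ f * ev w = ev w := by
  rcases h.ev_cases with h | h | h
  · exact absurd h hw
  · rw [h, ← mul_assoc, fff_eq]
  · rw [h, fff_eq]

lemma IsFWord.mul_self {w : List Gen} (h : IsFWord w) (hw : w ≠ []) :
    ev w * ev w = γ f * γ f := by
  rcases h.ev_cases with h | h | h
  · exact absurd h hw
  · rw [h, ← mul_assoc, fff_eq]
  · rw [h]

/-- The letter inverse to a letter `c, e, x, y` on `S¹aS¹`. -/
def inv : Gen → Gen
  | c => e
  | e => c
  | x => y
  | y => x
  | g => g

lemma unitLetter_comm {g h : Gen} (hg : IsUnitLetter g) (hh : IsUnitLetter h) :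
    γ g * γ h = γ h * γ g := by
  have := ec_eq; have := ex_eq; have := ey_eq; have := cx_eq; have := cy_eq; have := xy_eq
  rcases hg with rfl | rfl | rfl | rfl <;> rcases hh with rfl | rfl | rfl | rfl <;>
    first | rfl | assumption | (symm; assumption)

lemma isUnitLetter_inv {g : Gen} (hg : IsUnitLetter g) : IsUnitLetter (inv g) := by
  rcases hg with rfl | rfl | rfl | rfl <;> simp [inv, IsUnitLetter]

lemma inv_mul_mul_a {g : Gen} (hg : IsUnitLetter g) : γ (inv g) * (γ g * γ a) = γ a := by
  rcases hg with rfl | rfl | rfl | rfl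
  · exact (mul_assoc _ _ _).symm.trans eca_eq
  · exact (mul_assoc _ _ _).symm.trans (ec_eq ▸ eca_eq)
  · exact yxa_eq
  · have := yxa_eq
    rw [← mul_assoc, ← xy_eq, mul_assoc] at this
    exact this

/-- A word which starts with a word in `c, e, x, y` followed by `a` is fixed by inverse pairs. -/
lemma inv_mul_mul_ev {g : Gen} (hg : IsUnitLetter g) {w : List Gen} (hw : a ∈ w)
    (h : lrun w none = none) : γ (inv g) * (γ g * ev w) = ev w := by
  induction w with
  | nil => simp at hw
  | cons k w ih =>
    by_cases hk : IsUnitLetter k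
    · have hw' : a ∈ w := by
        rcases List.mem_cons.1 hw with rfl | hw
        · simp [IsUnitLetter] at hk
        · exact hw
      have h' : lrun w none = none := by
        rcases hk with rfl | rfl | rfl | rfl <;> simpa [lstep] using h
      calc γ (inv g) * (γ g * ev (k :: w)) = γ (inv g) * (γ g * γ k) * ev w := by
            rw [ev_cons]; simp only [mul_assoc]
        _ = γ (inv g) * γ k * (γ g * ev w) := by
            rw [unitLetter_comm hg hk]; simp only [mul_assoc]
        _ = γ k * (γ (inv g) * (γ g * ev w)) := by
            rw [unitLetter_comm (isUnitLetter_inv hg) hk]; simp only [mul_assoc]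
        _ = ev (k :: w) := by rw [ih hw' h', ev_cons]
    · obtain rfl : k = a := by
        cases k <;> simp [IsUnitLetter, lstep] at hk h ⊢
      have := inv_mul_mul_a hg
      calc γ (inv g) * (γ g * ev (a :: w)) = γ (inv g) * (γ g * γ a) * ev w := by
            rw [ev_cons]; simp only [mul_assoc]
        _ = ev (a :: w) := by rw [this, ev_cons]

lemma IsUnitWord.lrun_none {w : List Gen} (h : IsUnitWord w) : lrun w none = none := by
  induction w with
  | nil => rfl
  | cons g w ih =>
    have hg := h g (by simp)
    have := ih fun g hg => h g (by simp [hg])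
    rw [lrun, List.foldr_cons, show List.foldr lstep none w = none from this]
    rcases hg with rfl | rfl | rfl | rfl <;> rfl

/-- Multiplying on the left by a word in `c, e, x, y` can be undone. -/
lemma IsUnitWord.exists_mul_eq {p w : List Gen} (hp : IsUnitWord p) (hw : a ∈ w)
    (h : lrun w none = none) : ∃ q : List Gen, ev q * (ev p * ev w) = ev w := by
  induction p with
  | nil => exact ⟨[], by simp⟩
  | cons g p ih =>
    have hp' : IsUnitWord p := fun g hg => hp g (by simp [hg])
    obtain ⟨q, hq⟩ := ih hp'
    refine ⟨q ++ [inv g], ?_⟩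
    have := inv_mul_mul_ev (hp g (by simp)) (w := p ++ w) (by simp [hw])
      (by rw [lrun, List.foldr_append]; exact (congrArg _ h).trans hp'.lrun_none)
    rw [ev_append] at this
    simp only [ev_append, ev_cons, ev_nil, mul_one]
    rw [mul_assoc, mul_assoc (γ g), this, hq]

/-! ### Dynamics of the two actions -/

lemma lrun_const {w : List Gen} (h : a ∈ w) (o o' : Option ℕ) : lrun w o = lrun w o' := by
  induction w with
  | nil => simp at h
  | cons g w ih =>
    rcases List.mem_cons.1 h with rfl | h
    · rfl
    · exact congrArg (lstep g) (ih h)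

/-- Once the count has started, each letter other than `a` and `f` raises it by one. -/
lemma lrun_some {w : List Gen} (h : a ∉ w) (k : ℕ) :
    ∃ l, lrun w (some k) = some l ∧ k ≤ l ∧ (l = k → IsFWord w) := by
  induction w with
  | nil => exact ⟨k, rfl, le_rfl, by simp [IsFWord]⟩
  | cons g w ih =>
    obtain ⟨hg, hw⟩ := not_or.1 (mt List.mem_cons.2 h)
    obtain ⟨l, hl, hkl, hf⟩ := ih hw
    have e1 : lrun (g :: w) (some k) = lstep g (some l) := congrArg _ hl
    rw [e1]
    by_cases hgf : g = f
    · subst hgf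
      exact ⟨l, rfl, hkl, fun h => by simpa [IsFWord] using hf h⟩
    · refine ⟨l + 1, ?_, by omega, by omega⟩
      cases g <;> simp [lstep] at hg hgf ⊢

lemma isUnitWord_of_lrun {w : List Gen} (h : a ∉ w) (hn : lrun w none = none) :
    IsUnitWord w := by
  induction w with
  | nil => simp [IsUnitWord]
  | cons g w ih =>
    obtain ⟨hg, hw⟩ := not_or.1 (mt List.mem_cons.2 h)
    have hgu : IsUnitLetter g := by
      cases g <;> simp [lstep, IsUnitLetter] at hn hg ⊢
    have hn' : lrun w none = none := by
      rcases hgu with rfl | rfl | rfl | rfl <;> simpa [lstep] using hn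
    intro k hk
    rcases List.mem_cons.1 hk with rfl | hk
    · exact hgu
    · exact ih hw hn' k hk

lemma run_pend {w : List Gen} (h : a ∉ w) (k : ℕ) (i j : ℤ) :
    ∃ i' j', run (pend k i j) w = pend (k + nonF w) i' j' := by
  induction w generalizing k i j with
  | nil => exact ⟨i, j, rfl⟩
  | cons g w ih =>
    obtain ⟨hg, hw⟩ := not_or.1 (mt List.mem_cons.2 h)
    by_cases hgf : g = f
    · subst hgf
      exact ih hw k 0 0
    · have : ∃ i₁ j₁, step (pend k i j) g = pend (k + 1) i₁ j₁ := by
        cases g <;> simp [step] at hg hgf ⊢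
      obtain ⟨i₁, j₁, h₁⟩ := this
      obtain ⟨i', j', hl⟩ := ih hw (k + 1) i₁ j₁
      refine ⟨i', j', ?_⟩
      rw [run, List.foldl_cons, h₁, nonF, List.countP_cons_of_pos (by simpa using hgf),
        add_comm (List.countP _ _), ← add_assoc]
      exact hl

/-- Along a word without `a`, live states move up lexicographically, and strictly so unless the word
is a power of `f`. -/
lemma run_live {w : List Gen} (h : a ∉ w) {i j i' j' : ℤ} {t t' : Bool}
    (hr : run (live i j t) w = live i' j' t') :
    i ≤ i' ∧ (i = i' → j ≤ j' ∧ (j = j' → IsFWord w)) := by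
  induction w generalizing i j t with
  | nil =>
    simp only [run, List.foldl_nil, live.injEq] at hr
    obtain ⟨rfl, rfl, -⟩ := hr
    simp [IsFWord]
  | cons g w ih =>
    obtain ⟨hg, hw⟩ := not_or.1 (mt List.mem_cons.2 h)
    have hp : ∀ k i₁ j₁, step (live i j t) g ≠ pend k i₁ j₁ := by
      intro k i₁ j₁ h₁
      rw [run, List.foldl_cons, h₁] at hr
      obtain ⟨i₂, j₂, h₂⟩ := run_pend hw k i₁ j₁
      cases h₂.symm.trans hr
    rw [run, List.foldl_cons] at hr
    cases g
    case a => exact absurd rfl hg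
    case f =>
      obtain ⟨h₁, h₂⟩ := ih hw hr
      refine ⟨h₁, fun h => ⟨(h₂ h).1, fun h' => ?_⟩⟩
      simpa [IsFWord] using (h₂ h).2 h'
    case b =>
      cases t
      · obtain ⟨h₁, h₂⟩ := ih hw hr
        refine ⟨h₁, fun h => ?_⟩
        have := (h₂ h).1
        exact ⟨by omega, by omega⟩
      · exact absurd rfl (hp _ _ _)
    case d =>
      cases t
      · exact absurd rfl (hp _ _ _)
      · obtain ⟨h₁, h₂⟩ := ih hw hr
        exact ⟨by omega, by omega⟩
    all_goals exact absurd rfl (hp _ _ _)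

/-- Without `a`, every letter other than `f` strictly increases the count of a pending state or the
lexicographic position of a state that stays live, so no such letter can occur on a loop. -/
lemma isFWord_of_run_eq {w : List Gen} (h : a ∉ w) {s : State} (hs : run s w = s) :
    IsFWord w := by
  cases s with
  | pend k i j =>
    obtain ⟨i', j', h₁⟩ := run_pend h k i j
    rw [h₁] at hs
    injection hs with hs
    exact nonF_eq_zero.1 (by omega)
  | live i j t => exact ((run_live h hs).2 rfl).2 rfl

/-! ### The dichotomy between live and constant words -/

/-- The word has the value `zaf` or `za`, where `z` is a word in `c, e, x, y`. -/
def IsLive (w : List Gen) : Prop :=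
  ∃ (z : List Gen) (t : Bool), IsUnitWord z ∧ ev w = ev z * γ a * (if t then γ f else 1)

/-- The final state does not depend on the initial state, as long as this is pending. -/
def IsConst (w : List Gen) : Prop :=
  ∃ s, ∀ k i j, run (pend k i j) w = s

lemma IsConst.append_singleton {w : List Gen} (h : IsConst w) (g : Gen) : IsConst (w ++ [g]) := by
  obtain ⟨s, hs⟩ := h
  exact ⟨step s g, fun k i j => by rw [run, List.foldl_append]; simp [hs]⟩

lemma isConst_or_live_append_singleton {w : List Gen} (h : ∃ (z : List Gen) (t : Bool) (i₀ j₀ : ℤ), IsUnitWord z ∧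
      ev w = ev z * γ a * (if t then γ f else 1) ∧
      ∀ k i j, run (pend k i j) w = live (i + i₀) (j + j₀) t) (g : Gen) :
    IsConst (w ++ [g]) ∨ ∃ (z : List Gen) (t : Bool) (i₀ j₀ : ℤ), IsUnitWord z ∧
      ev (w ++ [g]) = ev z * γ a * (if t then γ f else 1) ∧
      ∀ k i j, run (pend k i j) (w ++ [g]) = live (i + i₀) (j + j₀) t := by
  obtain ⟨z, t, i₀, j₀, hz, hw, hr⟩ := h
  have hst : ∀ k i j, run (pend k i j) (w ++ [g]) = step (live (i + i₀) (j + j₀) t) g := by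
    intro k i j
    rw [run, List.foldl_append, ← hr k]
    rfl
  cases g
  case f =>
    refine Or.inr ⟨z, !t, i₀, j₀, hz, ?_, hst⟩
    cases t
    · simp [hw]
    · have := aff_eq
      simp only [mul_assoc] at this
      simp [hw, mul_assoc, this]
  case b =>
    cases t
    · refine Or.inr ⟨z ++ [x], true, i₀, j₀ + 1, ?_, ?_, ?_⟩
      · exact isUnitWord_append.2 ⟨hz, by simp [IsUnitWord, IsUnitLetter]⟩
      · have := xaf_eq
        simp only [mul_assoc] at this
        simp [hw, mul_assoc, this]
      · intro k i j
        rw [hst, ← add_assoc]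
        rfl
    · exact Or.inl ⟨_, hst⟩
  case d =>
    cases t
    · exact Or.inl ⟨_, hst⟩
    · refine Or.inr ⟨z ++ [e, y], false, i₀ + 1, j₀ - 1, ?_, ?_, ?_⟩
      · exact isUnitWord_append.2 ⟨hz, by simp [IsUnitWord, IsUnitLetter]⟩
      · have := afd_eq
        simp only [mul_assoc] at this
        simp [hw, mul_assoc, this]
      · intro k i j
        rw [hst, ← add_assoc, ← add_sub_assoc]
        rfl
  all_goals exact Or.inl ⟨_, hst⟩

lemma isConst_or_isLive (w : List Gen) (h : a ∈ w) : IsConst w ∨ IsLive w := by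
  -- Induction on prefixes needs two further cases without `a`: the initial exponents are shifted,
  -- or a letter `b`, `d` or `f` has erased them. The next `a` makes the word live in the first
  -- case, constant in the second.
  suffices H : (IsUnitWord w ∧ ∃ i₀ j₀, ∀ k i j, ∃ l, run (pend k i j) w = pend l (i + i₀) (j + j₀)) ∨
      (a ∉ w ∧ ∃ i₀ j₀, ∀ k i j, ∃ l, run (pend k i j) w = pend l i₀ j₀) ∨
      IsConst w ∨ ∃ (z : List Gen) (t : Bool) (i₀ j₀ : ℤ), IsUnitWord z ∧ ev w = ev z * γ a * (if t then γ f else 1) ∧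
        ∀ k i j, run (pend k i j) w = live (i + i₀) (j + j₀) t by
    rcases H with ⟨H, -⟩ | ⟨H, -⟩ | H | ⟨z, t, -, -, hz, hw, -⟩
    · exact absurd (H a h) (by simp [IsUnitLetter])
    · exact absurd h H
    · exact Or.inl H
    · exact Or.inr ⟨z, t, hz, hw⟩
  clear h
  induction w using List.reverseRecOn with
  | nil => exact Or.inl ⟨by simp [IsUnitWord], 0, 0, fun k i j => ⟨k, by simp⟩⟩
  | append_singleton w g ih =>
    rcases ih with ⟨H, i₀, j₀, hr⟩ | ⟨H, i₀, j₀, hr⟩ | H | H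
    · have hst : ∀ k i j, ∃ l, run (pend k i j) (w ++ [g]) = step (pend l (i + i₀) (j + j₀)) g := by
        intro k i j
        obtain ⟨l, hl⟩ := hr k i j
        exact ⟨l, by rw [run, List.foldl_append, ← hl]; rfl⟩
      have haw : a ∉ w := fun h => absurd (H a h) (by simp [IsUnitLetter])
      by_cases hg : IsUnitLetter g
      · refine Or.inl ⟨isUnitWord_append.2 ⟨H, by simpa [IsUnitWord] using hg⟩, ?_⟩
        have : ∃ i₁ j₁, ∀ k i j, step (pend k i j) g = pend (k + 1) (i + i₁) (j + j₁) := by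
          rcases hg with rfl | rfl | rfl | rfl
          · exact ⟨-1, 0, fun k i j => by simp [step, sub_eq_add_neg]⟩
          · exact ⟨1, 0, fun k i j => by simp [step]⟩
          · exact ⟨0, 1, fun k i j => by simp [step]⟩
          · exact ⟨0, -1, fun k i j => by simp [step, sub_eq_add_neg]⟩
        obtain ⟨i₁, j₁, h₁⟩ := this
        refine ⟨i₀ + i₁, j₀ + j₁, fun k i j => ?_⟩
        obtain ⟨l, hl⟩ := hst k i j
        exact ⟨l + 1, by rw [hl, h₁, add_assoc, add_assoc]⟩
      · by_cases hga : g = a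
        · subst hga
          refine Or.inr (Or.inr (Or.inr ⟨w, false, i₀, j₀, H, by simp, fun k i j => ?_⟩))
          obtain ⟨l, hl⟩ := hst k i j
          exact hl
        · refine Or.inr (Or.inl ⟨by simp [haw, Ne.symm hga], 0, 0, fun k i j => ?_⟩)
          obtain ⟨l, hl⟩ := hst k i j
          rw [hl]
          cases g <;> simp [IsUnitLetter, step] at hg hga ⊢
    · have hst : ∀ k i j, ∃ l, run (pend k i j) (w ++ [g]) = step (pend l i₀ j₀) g := by
        intro k i j
        obtain ⟨l, hl⟩ := hr k i j
        exact ⟨l, by rw [run, List.foldl_append, ← hl]; rfl⟩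
      by_cases hga : g = a
      · subst hga
        refine Or.inr (Or.inr (Or.inl ⟨live i₀ j₀ false, fun k i j => ?_⟩))
        obtain ⟨l, hl⟩ := hst k i j
        exact hl
      · refine Or.inr (Or.inl ⟨by simp [H, Ne.symm hga], ?_⟩)
        have : ∃ i₁ j₁, ∀ k, ∃ l, step (pend k i₀ j₀) g = pend l i₁ j₁ := by
          cases g <;> simp [step] at hga ⊢
        obtain ⟨i₁, j₁, h₁⟩ := this
        refine ⟨i₁, j₁, fun k i j => ?_⟩
        obtain ⟨l, hl⟩ := hst k i j
        rw [hl]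
        exact h₁ l
    · exact Or.inr (Or.inr (Or.inl (H.append_singleton g)))
    · exact Or.inr (Or.inr (isConst_or_live_append_singleton H g))

/-! ### Green's relations on `S` -/

section Factorization

variable {u p q : List Gen}

lemma notMem_a_of_eq (h : ev u = ev (p ++ u ++ q)) : a ∉ p ∧ a ∉ q := by
  have := count_a_eq h
  simp only [List.count_append] at this
  rw [← List.count_eq_zero, ← List.count_eq_zero]
  omega

lemma isFWord_of_notMem_a (hu : a ∉ u) (h : ev u = ev (p ++ u ++ q)) :
    IsFWord p ∧ IsFWord q := by
  obtain ⟨hp, hq⟩ := notMem_a_of_eq h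
  have hr := run_eq h (pend 0 0 0)
  obtain ⟨i, j, h₁⟩ := run_pend hu 0 0 0
  obtain ⟨i', j', h₂⟩ := run_pend (w := p ++ u ++ q) (by simp [hp, hu, hq]) 0 0 0
  rw [h₁, h₂] at hr
  injection hr with hr
  simp only [nonF, List.countP_append] at hr
  exact ⟨nonF_eq_zero.1 (by rw [nonF]; omega), nonF_eq_zero.1 (by rw [nonF]; omega)⟩

/-- As `u` contains `a`, the left action does not see `q`; hence `p` fixes `lrun u none`. A fixed
number forces a power of `f`, a fixed `none` a word in `c, e, x, y`. -/
lemma isFWord_or_isUnitWord (hu : a ∈ u) (h : ev u = ev (p ++ u ++ q)) :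
    IsFWord p ∨ IsUnitWord p ∧ lrun u none = none := by
  obtain ⟨hp, hq⟩ := notMem_a_of_eq h
  have hr := lrun_eq h none
  rw [lrun, lrun, List.foldr_append, List.foldr_append] at hr
  rw [show List.foldr lstep (List.foldr lstep none q) u = lrun u none from
    lrun_const hu _ _] at hr
  rcases hn : lrun u none with _ | k
  · rw [hn] at hr
    exact Or.inr ⟨isUnitWord_of_lrun hp (hr.symm.trans hn), rfl⟩
  · rw [hn] at hr
    obtain ⟨l, hl, -, hf⟩ := lrun_some hp k
    refine Or.inl (hf ?_)
    have := (hr.symm.trans hn).symm.trans hl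
    exact (Option.some.inj this).symm

/-- Reading `p` leaves the state pending, so `u` ends in the same state with or without `p`, and `q`
is a loop at that state. -/
lemma isFWord_of_isConst (hc : IsConst u) (h : ev u = ev (p ++ u ++ q)) : IsFWord q := by
  obtain ⟨hp, hq⟩ := notMem_a_of_eq h
  have hr := run_eq h (pend 0 0 0)
  obtain ⟨s, hs⟩ := hc
  obtain ⟨i, j, hl⟩ := run_pend hp 0 0 0
  rw [run, run, List.foldl_append, List.foldl_append,
    show List.foldl step (pend 0 0 0) p = _ from hl,
    show List.foldl step (pend _ i j) u = _ from hs _ _ _,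
    show List.foldl step (pend 0 0 0) u = _ from hs _ _ _] at hr
  exact isFWord_of_run_eq hq hr.symm

lemma exists_left_inverse {p' : List Gen} (h : ev u = ev (p ++ p' ++ u ++ q)) :
    ∃ r : List Gen, ev r * (ev p' * ev u) = ev u := by
  have hF : IsFWord (p ++ p') → ∃ r : List Gen, ev r * (ev p' * ev u) = ev u := by
    intro hF
    by_cases hp' : p' = []
    · exact ⟨[], by simp [hp']⟩
    -- A nonempty power of `f` squares to `ff`, and `ff` fixes `u` because `u` is a left multiple of
    -- a nonempty power of `f`.
    · refine ⟨p', ?_⟩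
      rw [← mul_assoc, (isFWord_append.1 hF).2.mul_self hp']
      conv_lhs => rw [h, List.append_assoc, ev_append, ← mul_assoc, hF.ff_mul (by simp [hp'])]
      rw [← ev_append, ← List.append_assoc, ← h]
  by_cases hu : a ∈ u
  · rcases isFWord_or_isUnitWord hu h with hp | ⟨hp, hu'⟩
    · exact hF hp
    · exact (isUnitWord_append.1 hp).2.exists_mul_eq hu hu'
  · exact hF (isFWord_of_notMem_a hu h).1

lemma exists_right_inverse {q' : List Gen} (h : ev u = ev (p ++ u ++ (q' ++ q)))
    (hq : IsFWord (q' ++ q)) : ∃ r : List Gen, ev u * ev q' * ev r = ev u := by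
  by_cases hq' : q' = []
  · exact ⟨[], by simp [hq']⟩
  · refine ⟨q', ?_⟩
    rw [mul_assoc, (isFWord_append.1 hq).1.mul_self hq']
    conv_lhs => rw [h, ev_append, mul_assoc, hq.mul_ff (by simp [hq'])]
    rw [← ev_append, ← h]

end Factorization

lemma exists_coe_eq_mul (p : WithOne S) (u : S) : ∃ m : S, (m : WithOne S) = p * u := by
  cases p with
  | one => exact ⟨u, (one_mul _).symm⟩
  | coe p => exact ⟨p * u, rfl⟩

lemma exists_mul_live_eq {z z' : List Gen} (hz : IsUnitWord z) (r : WithOne S) :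
    ∃ q : WithOne S, ev z' * γ a * r = q * (ev z * γ a * r) := by
  obtain ⟨q, hq⟩ := hz.exists_mul_eq (w := [a]) (by simp) rfl
  simp only [ev_cons, ev_nil, mul_one] at hq
  refine ⟨ev z' * ev q, ?_⟩
  calc _ = ev z' * (ev q * (ev z * γ a)) * r := by rw [hq]
    _ = _ := by simp only [mul_assoc]

lemma exists_live_mul_eq (t t' : Bool) : ∃ r : WithOne S,
    γ a * (if t' then γ f else 1) = γ a * (if t then γ f else 1) * r := by
  cases t <;> cases t'
  · exact ⟨1, by simp⟩
  · exact ⟨γ f, by simp⟩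
  · exact ⟨γ f, by simp [aff_eq]⟩
  · exact ⟨1, by simp⟩

lemma greenD_of_isLive {u v : S} {u' v' : List Gen} (hu : ev u' = u) (hv : ev v' = v)
    (hul : IsLive u') (hvl : IsLive v') : GreenD S u v := by
  obtain ⟨z, t, hz, hzt⟩ := hul
  obtain ⟨z', t', hz', hzt'⟩ := hvl
  obtain ⟨q, hq⟩ := exists_mul_live_eq (z' := z') hz (if t then γ f else 1)
  obtain ⟨q', hq'⟩ := exists_mul_live_eq (z' := z) hz' (if t then γ f else 1)
  obtain ⟨r, hr⟩ := exists_live_mul_eq t t'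
  obtain ⟨r', hr'⟩ := exists_live_mul_eq t' t
  obtain ⟨m, hm⟩ := exists_coe_eq_mul q u
  have hm' : (m : WithOne S) = ev z' * γ a * (if t then γ f else 1) := by
    rw [hm, ← hu, hzt, hq]
  -- The intermediate element takes its left factor `z'` from `v` and its ending `a` or `af` from
  -- `u`.
  refine ⟨m, greenL_iff.2 ⟨⟨q', ?_⟩, ⟨q, hm⟩⟩, greenR_iff.2 ⟨⟨r', ?_⟩, ⟨r, ?_⟩⟩⟩
  · rw [hm', ← hu, hzt, hq']
  · rw [hm', ← hv, hzt', mul_assoc, hr']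
    simp only [mul_assoc]
  · rw [hm', ← hv, hzt', mul_assoc, hr]
    simp only [mul_assoc]

theorem greenJ_eq_greenD : GreenJ S = GreenD S := by
  funext u v
  refine propext ⟨fun h => ?_, GreenD.greenJ⟩
  obtain ⟨⟨p, q, hu⟩, ⟨p', q', hv⟩⟩ := greenJ_iff.1 h
  obtain ⟨p, rfl⟩ := exists_ev p
  obtain ⟨q, rfl⟩ := exists_ev q
  obtain ⟨p', rfl⟩ := exists_ev p'
  obtain ⟨q', rfl⟩ := exists_ev q'
  obtain ⟨wu, hwu⟩ := exists_ev_coe u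
  obtain ⟨wv, hwv⟩ := exists_ev_coe v
  have h₁ : ev wu = ev (p ++ p' ++ wu ++ (q' ++ q)) := by
    conv_lhs => rw [hwu, hu, hv, ← hwu]
    simp only [ev_append, mul_assoc]
  have h₂ : ev wv = ev (p' ++ p ++ wv ++ (q ++ q')) := by
    conv_lhs => rw [hwv, hv, hu, ← hwv]
    simp only [ev_append, mul_assoc]
  have hD : IsFWord (q' ++ q) → GreenD S u v := by
    intro hq
    obtain ⟨m, hm⟩ := exists_coe_eq_mul (ev p') u
    obtain ⟨r, hr⟩ := exists_left_inverse h₁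
    obtain ⟨r', hr'⟩ := exists_right_inverse h₁ hq
    rw [hwu] at hr hr'
    refine ⟨m, greenL_iff.2 ⟨⟨ev r, by rw [hm, hr]⟩, ⟨ev p', hm⟩⟩,
      greenR_iff.2 ⟨⟨ev r', ?_⟩, ⟨ev q', by rw [hm, hv]⟩⟩⟩
    rw [hm, hv, mul_assoc, mul_assoc, ← mul_assoc (u : WithOne S), hr']
  by_cases hau : a ∈ wu
  · have hav : a ∈ wv := by
      have h₃ : ev wu = ev (p ++ wv ++ q) := by
        rw [hwu, hu, ← hwv]; simp only [ev_append]
      have h₄ := count_a_eq h₃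
      obtain ⟨hap, haq⟩ := notMem_a_of_eq h₁
      simp only [List.mem_append, not_or] at hap haq
      simp only [List.count_append, List.count_eq_zero.2 hap.1, List.count_eq_zero.2 haq.2] at h₄
      have := List.count_pos_iff.2 hau
      exact List.count_pos_iff.1 (by omega)
    rcases isConst_or_isLive wu hau with hcu | hlu
    · exact hD (isFWord_of_isConst hcu h₁)
    · rcases isConst_or_isLive wv hav with hcv | hlv
      · have := isFWord_append.1 (isFWord_of_isConst hcv h₂)
        exact hD (isFWord_append.2 ⟨this.2, this.1⟩)
      · exact greenD_of_isLive hwu hwv hlu hlv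
  · exact hD (isFWord_of_notMem_a hau h₁).2

/-! ### The subsemigroup `S \ {f}` -/

lemma isFWord_of_ev_eq {w : List Gen} (h : ev w = γ f) : IsFWord w := by
  have h' : ev w = ev [f] := by simp [h]
  have hw : a ∉ w := List.count_eq_zero.1 (count_a_eq h')
  have hr := run_eq h' (pend 0 0 0)
  obtain ⟨i, j, hij⟩ := run_pend hw 0 0 0
  rw [hij] at hr
  have hr' : pend (0 + nonF w) i j = pend 0 0 0 := hr
  injection hr' with hr'
  exact nonF_eq_zero.1 (by omega)

lemma gen_ne_f {g : Gen} (hg : g ≠ f) : gen g ≠ gen f := fun h =>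
  hg (isFWord_of_ev_eq (w := [g]) (by simp [h]) g (by simp))

/-- On a live state `f` flips the Boolean, so `ff` and `f` act differently. -/
lemma ff_ne_f : γ f * γ f ≠ γ f := by
  intro h
  have := run_eq (v := [f, f]) (w := [f]) (by simpa using h) (live 0 0 false)
  simp [step] at this

/-- The subsemigroup `S \ {f}`. -/
def complF : Subsemigroup S where
  carrier := {gen f}ᶜ
  mul_mem' := by
    intro u v hu hv huv
    obtain ⟨wu, hwu⟩ := exists_ev_coe u
    obtain ⟨wv, hwv⟩ := exists_ev_coe v
    have huv' : (u : WithOne S) * v = γ f := by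
      rw [← WithOne.coe_mul]; exact congrArg _ huv
    have hF := isFWord_of_ev_eq (w := wu ++ wv) (by rw [ev_append, hwu, hwv, huv'])
    have key : ∀ (u : S) (w : List Gen), u ∈ ({gen f}ᶜ : Set S) → ev w = u → IsFWord w →
        (u : WithOne S) = γ f * γ f := by
      intro u w hu hw hF
      rcases hF.ev_cases with rfl | h | h
      · exact absurd hw WithOne.one_ne_coe
      · rw [← hw, h]
      · exact absurd (WithOne.coe_injective (hw.symm.trans h)) hu
    -- Two factors of `f` other than `f` would both equal `ff`, whose square is `ff`.
    rw [isFWord_append] at hF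
    rw [key u wu hu hwu hF.1, key v wv hv hwv hF.2, ← mul_assoc, fff_eq] at huv'
    exact ff_ne_f huv'

/-- A generator other than `f`, as an element of `S \ {f}`. -/
def tgen (g : Gen) (hg : g ≠ f) : complF := ⟨gen g, gen_ne_f hg⟩

lemma af_mem : gen a * gen f ∈ complF := by
  intro h
  have := isFWord_of_ev_eq (w := [a, f])
    (by simpa using congrArg (WithOne.coe : S → WithOne S) h) a (by simp)
  cases this

/-- The element `af` of `S \ {f}`. -/
def taf : complF := ⟨gen a * gen f, af_mem⟩

lemma greenJ_complF : GreenJ complF (tgen a (by decide)) taf := by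
  -- The witnesses come from `a = cx·af·d` and `af = y·a·b`, which avoid multiplying by `f`.
  refine greenJ_iff.2 ⟨⟨(tgen c (by decide) * tgen x (by decide) : complF),
    tgen d (by decide), ?_⟩, ⟨tgen y (by decide), tgen b (by decide), ?_⟩⟩
  · rw [← WithOne.coe_mul, ← WithOne.coe_mul]
    refine congrArg _ (Subtype.ext (WithOne.coe_injective ?_))
    refine Eq.trans cxafd_eq.symm ?_
    rw [← mul_assoc, ← mul_assoc]
    rfl
  · rw [← WithOne.coe_mul, ← WithOne.coe_mul]
    refine congrArg _ (Subtype.ext (WithOne.coe_injective ?_))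
    have : γ a * γ f = γ y * γ a * γ b := by
      rw [mul_assoc, ← xaf_eq, ← mul_assoc, yxa_eq]
    exact this

/-- The inclusion of `S \ {f}`, extended to the adjoined identities. -/
def incl : WithOne complF →* WithOne S := WithOne.mapMulHom (MulMemClass.subtype complF)

lemma incl_ne (p : WithOne complF) : incl p ≠ γ f := by
  cases p with
  | one => exact WithOne.one_ne_coe
  | coe t => exact fun h => t.2 (WithOne.coe_injective h)

lemma not_greenD_complF : ¬ GreenD complF (tgen a (by decide)) taf := by
  rintro ⟨m, hL, hR⟩
  obtain ⟨-, ⟨p, hp⟩⟩ := greenL_iff.1 hL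
  obtain ⟨⟨q, hq⟩, ⟨r, hr⟩⟩ := greenR_iff.1 hR
  have hp' := congrArg incl hp
  have hq' := congrArg incl hq
  have hr' := congrArg incl hr
  have hrf := incl_ne r
  rw [map_mul] at hp' hq' hr'
  obtain ⟨p, hp⟩ := exists_ev (incl p)
  obtain ⟨q, hq⟩ := exists_ev (incl q)
  obtain ⟨r, hr⟩ := exists_ev (incl r)
  have ha : incl (tgen a (by decide) : complF) = γ a := rfl
  have haf : incl (taf : complF) = γ a * γ f := rfl
  rw [hp', haf, ← hp, ← hq, ha] at hq'
  rw [hp', haf, ← hp, ← hr, ha] at hr'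
  rw [← hr] at hrf
  have h₁ : ev (p ++ [a]) = ev ([a, f] ++ q) := by simpa [mul_assoc] using hq'
  have h₂ : ev [a, f] = ev (p ++ [a] ++ r) := by simpa [mul_assoc] using hr'
  have c₁ := count_a_eq h₁
  have c₂ := count_a_eq h₂
  simp only [List.count_append] at c₁ c₂
  have e₁ : List.count a [a] = 1 := rfl
  have e₂ : List.count a [a, f] = 1 := rfl
  have hap : a ∉ p := List.count_eq_zero.1 (by omega)
  have haq : a ∉ q := List.count_eq_zero.1 (by omega)
  have har : a ∉ r := List.count_eq_zero.1 (by omega)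
  have r₁ := run_eq h₁ (pend 0 0 0)
  have r₂ := run_eq h₂ (pend 0 0 0)
  obtain ⟨i, j, hij⟩ := run_pend hap 0 0 0
  have hpa : run (pend 0 0 0) (p ++ [a]) = live i j false := by
    rw [run, List.foldl_append, show List.foldl step (pend 0 0 0) p = _ from hij]; rfl
  have r₁' : live i j false = run (live 0 0 true) q := hpa.symm.trans r₁
  have r₂' : live 0 0 true = run (live i j false) r := by
    rw [← hpa, run, ← List.foldl_append]; exact r₂
  -- From `af`, reading `q` leads to the state of `pa` and reading `r` leads back.
  have hF : IsFWord (q ++ r) := by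
    apply isFWord_of_run_eq (s := live 0 0 true) (by simp [haq, har])
    rw [run, List.foldl_append, show List.foldl step (live 0 0 true) q = _ from r₁'.symm]
    exact r₂'.symm
  -- The word `r` must turn `false` into `true`, which the empty word and `ff` do not.
  rcases (isFWord_append.1 hF).2.ev_cases with rfl | h | h
  · cases r₂'
  · rw [run_eq (w := [f, f]) (by simpa using h)] at r₂'
    cases r₂'
  · exact hrf h

end SemigroupExample

theorem mainTheorem5 :
    ∃ T : Subsemigroup SemigroupExample.S,
      (T : Set SemigroupExample.S) = {SemigroupExample.gen SemigroupExample.Gen.f}ᶜ ∧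
      SemigroupExample.IsLarge T ∧
      SemigroupExample.GreenJ SemigroupExample.S = SemigroupExample.GreenD SemigroupExample.S ∧
      SemigroupExample.GreenJ T ≠ SemigroupExample.GreenD T := by
  refine ⟨SemigroupExample.complF, rfl, ?_, SemigroupExample.greenJ_eq_greenD, fun h => ?_⟩
  · rw [SemigroupExample.IsLarge, show (SemigroupExample.complF : Set SemigroupExample.S) =
      {SemigroupExample.gen SemigroupExample.Gen.f}ᶜ from rfl, compl_compl]
    exact Set.finite_singleton _
  · exact SemigroupExample.not_greenD_complF (h ▸ SemigroupExample.greenJ_complF)
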